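/- Let $m\ge n\ge 0$ be integers, let $X\subset\mathbb{C}^m$ be an algebraic subvariety (the common zero set of a set of polynomials, not necessarily irreducible), and let $f:X\to\mathbb{C}^n$ be a polynomial map, i.e. a map whose components are restrictions to $X$ of polynomials on $\mathbb{C}^m$. Then there is a polynomial map $F:\mathbb{C}^m\to\mathbb{C}^n$ with $F|_X=f$ such that $$\dim\bigl(F^{-1}(z)\setminus X\bigr)\le m-n\qquad\text{for every } z\in\mathbb{C}^n.$$ Here $\dim$ denotes dimension in the Zariski topology, with $\dim\varnothing=-\infty$. -/

import Mathlib

/-- A subset of `ℂᵐ` is an algebraic subvariety if it is the common zero set of an ideal of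
polynomials. (It need not be irreducible or non-empty.) -/
def IsAlgebraicSubvariety {m : ℕ} (X : Set (Fin m → ℂ)) : Prop :=
  ∃ I : Ideal (MvPolynomial (Fin m) ℂ), X = MvPolynomial.zeroLocus ℂ I

theorem isAlgebraicSubvariety_empty {m : ℕ} :
    IsAlgebraicSubvariety (∅ : Set (Fin m → ℂ)) :=
  ⟨⊤, MvPolynomial.zeroLocus_top.symm⟩

theorem isAlgebraicSubvariety_sInter {m : ℕ} (A : Set (Set (Fin m → ℂ)))
    (hA : ∀ X ∈ A, IsAlgebraicSubvariety X) : IsAlgebraicSubvariety (⋂₀ A) := by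
  refine ⟨⨆ X ∈ A, MvPolynomial.vanishingIdeal ℂ X, Set.Subset.antisymm ?_ ?_⟩
  · refine MvPolynomial.le_zeroLocus_iff_le_vanishingIdeal.2 ?_
    exact iSup₂_le fun X hX =>
      MvPolynomial.vanishingIdeal_anti_mono (Set.sInter_subset_of_mem hX)
  · intro x hx X hX
    obtain ⟨I, rfl⟩ := hA X hX
    intro p hp
    exact hx p (le_iSup₂_of_le (f := fun X (_ : X ∈ A) => MvPolynomial.vanishingIdeal ℂ X)
      _ hX (MvPolynomial.le_vanishingIdeal_zeroLocus I) hp)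

theorem isAlgebraicSubvariety_union {m : ℕ} (X Y : Set (Fin m → ℂ))
    (hX : IsAlgebraicSubvariety X) (hY : IsAlgebraicSubvariety Y) :
    IsAlgebraicSubvariety (X ∪ Y) := by
  obtain ⟨I, rfl⟩ := hX
  obtain ⟨J, rfl⟩ := hY
  refine ⟨I * J, Set.Subset.antisymm ?_ ?_⟩
  · rintro x (hx | hx)
    · exact MvPolynomial.zeroLocus_anti_mono Ideal.mul_le_left hx
    · exact MvPolynomial.zeroLocus_anti_mono Ideal.mul_le_right hx
  · intro x hx
    by_contra h
    simp only [Set.mem_union, MvPolynomial.mem_zeroLocus_iff, not_or, not_forall] at h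
    obtain ⟨⟨p, hp, hpx⟩, q, hq, hqx⟩ := h
    have := hx (p * q) (Ideal.mul_mem_mul hp hq)
    rw [map_mul] at this
    exact (mul_ne_zero hpx hqx) this

/-- The Zariski topology on `ℂᵐ`: the closed sets are the algebraic subvarieties. -/
abbrev zariskiTopology (m : ℕ) : TopologicalSpace (Fin m → ℂ) :=
  TopologicalSpace.ofClosed {X | IsAlgebraicSubvariety X} isAlgebraicSubvariety_empty
    (fun A hA => isAlgebraicSubvariety_sInter A fun _ hX => hA hX)
    (fun X hX Y hY => isAlgebraicSubvariety_union X Y hX hY)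

/-- The dimension of a subset of `ℂᵐ`: the Krull dimension of its subspace Zariski topology, that
is, the supremum of the lengths of chains of irreducible relatively closed subsets. The dimension
of the empty set is `⊥`. -/
noncomputable def zariskiDim {m : ℕ} (S : Set (Fin m → ℂ)) : WithBot ℕ∞ :=
  @topologicalKrullDim S (TopologicalSpace.induced Subtype.val (zariskiTopology m))

/-- A map `F : ℂᵐ → ℂⁿ` is polynomial if all its components are polynomials. -/
def IsPolynomialMap {m n : ℕ} (F : (Fin m → ℂ) → (Fin n → ℂ)) : Prop :=
  ∃ P : Fin n → MvPolynomial (Fin m) ℂ, ∀ x i, F x i = MvPolynomial.eval x (P i)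

/-- A map `f : X → ℂⁿ` on a subset `X` of `ℂᵐ` is polynomial if all its components are
restrictions to `X` of polynomials on `ℂᵐ`. -/
def IsPolynomialMapOn {m n : ℕ} (X : Set (Fin m → ℂ)) (f : X → (Fin n → ℂ)) : Prop :=
  ∃ P : Fin n → MvPolynomial (Fin m) ℂ, ∀ (x : X) (i : Fin n), f x i = MvPolynomial.eval x.1 (P i)

/-! Let `X` be the zero locus of `I`, with `I` generated by finitely many `g`. Start with lifts of
the components of `f` and with all `g` and `X i * g`, which lie in `I`. While there are more than
`m` polynomials they are dependent; subtracting multiples of one element of `I` from the others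
makes it integral over them, and it is dropped (`exists_isIntegral_adjoin_mod_ideal`). The lifts
change only modulo `I`, so they still restrict to `f`, and at most `m - n` further polynomials `h j`
remain. Off `X` some `g` is nonzero and the coordinates are `(X i * g) / g`, so `(F, h)` is
quasi-finite there. On a fibre of `F` the map `h` alone is then quasi-finite, which bounds the
dimension (`comap_aeval_lt_comap_aeval`, `zariskiDim_le_of_isIntegral`). -/

namespace Polynomial

/-! ### Leading coefficients along lines. -/

theorem natDegree_prod_le_and_coeff_prod {R ι : Type*} [CommRing R] (s : Finset ι)
    (f : ι → R[X]) (e : ι → ℕ) (hf : ∀ i ∈ s, (f i).natDegree ≤ e i) :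
    (∏ i ∈ s, f i).natDegree ≤ ∑ i ∈ s, e i ∧
      (∏ i ∈ s, f i).coeff (∑ i ∈ s, e i) = ∏ i ∈ s, (f i).coeff (e i) := by
  classical
  induction s using Finset.induction_on with
  | empty => simp
  | insert i s hi ih =>
    obtain ⟨h₁, h₂⟩ := ih fun j hj => hf j (Finset.mem_insert_of_mem hj)
    have h₃ := hf i (Finset.mem_insert_self i s)
    simp only [Finset.prod_insert hi, Finset.sum_insert hi]
    exact ⟨natDegree_mul_le_of_le h₃ h₁, by rw [coeff_mul_add_eq_of_natDegree_le h₃ h₁, h₂]⟩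

end Polynomial

namespace MvPolynomial

/-- Substituting the line `T ↦ u + T a` into a polynomial of degree at most `d` gives a polynomial
of degree at most `d` in `T`, whose coefficient at `T ^ d` is the value at `a` of the homogeneous
component of degree `d`. -/
theorem natDegree_aeval_line_le_and_coeff {k R σ : Type*} [Field k] [CommRing R] [Algebra k R]
    [Finite σ] (u : σ → R) (a : σ → k) (p : MvPolynomial σ k) (d : ℕ) (hp : p.totalDegree ≤ d) :
    (aeval (fun i => Polynomial.C (u i) + Polynomial.C (algebraMap k R (a i)) * Polynomial.X)
        p).natDegree ≤ d ∧
      (aeval (fun i => Polynomial.C (u i) + Polynomial.C (algebraMap k R (a i)) * Polynomial.X)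
        p).coeff d = algebraMap k R (eval a (homogeneousComponent d p)) := by
  classical
  have := Fintype.ofFinite σ
  set L : σ → Polynomial R :=
    fun i => Polynomial.C (u i) + Polynomial.C (algebraMap k R (a i)) * Polynomial.X with hL
  have hLd (i : σ) : (L i).natDegree ≤ 1 := by
    rw [hL]; dsimp only; compute_degree
  have hLc (i : σ) : (L i).coeff 1 = algebraMap k R (a i) := by
    simp [hL, Polynomial.coeff_C]
  have key (s : σ →₀ ℕ) :
      (∏ i, L i ^ s i).natDegree ≤ s.degree ∧
        (∏ i, L i ^ s i).coeff s.degree = ∏ i, algebraMap k R (a i) ^ s i := by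
    have := Polynomial.natDegree_prod_le_and_coeff_prod Finset.univ (fun i => L i ^ s i) s
      fun i _ => by simpa using Polynomial.natDegree_pow_le_of_le (s i) (hLd i)
    rw [Finsupp.degree_eq_sum]
    refine ⟨this.1, this.2.trans (Finset.prod_congr rfl fun i _ => ?_)⟩
    have := Polynomial.coeff_pow_of_natDegree_le (m := s i) (hLd i)
    rwa [mul_one, hLc] at this
  have hmon (s : σ →₀ ℕ) (hs : s ∈ p.support) : s.degree ≤ d :=
    le_trans (by simpa [Finsupp.degree_eq_sum, Finsupp.sum_fintype] using le_totalDegree hs) hp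
  have hsum : aeval L p =
      ∑ s ∈ p.support, Polynomial.C (algebraMap k R (coeff s p)) * ∏ i, L i ^ s i := by
    rw [aeval_def, eval₂_eq']
    rfl
  rw [hsum]
  constructor
  · refine Polynomial.natDegree_sum_le_of_forall_le _ _ fun s hs => ?_
    exact (Polynomial.natDegree_C_mul_le _ _).trans ((key s).1.trans (hmon s hs))
  · rw [Polynomial.finsetSum_coeff, homogeneousComponent_apply, map_sum, map_sum,
      Finset.sum_filter]
    refine Finset.sum_congr rfl fun s hs => ?_
    rw [Polynomial.coeff_C_mul]
    split_ifs with h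
    · rw [← h, (key s).2, eval_monomial, Finsupp.prod_fintype _ _ (by simp)]
      simp
    · rw [Polynomial.coeff_eq_zero_of_natDegree_lt, mul_zero]
      exact (key s).1.trans_lt (lt_of_le_of_ne (hmon s hs) h)

/-- A nonzero homogeneous polynomial over an infinite field is nonzero at some point with a given
coordinate equal to `1`. -/
theorem IsHomogeneous.exists_eval_ne_zero {k σ : Type*} [Field k] [Infinite k]
    {p : MvPolynomial σ k} {d : ℕ} (hp : p.IsHomogeneous d) (h0 : p ≠ 0) (i : σ) :
    ∃ a : σ → k, a i = 1 ∧ eval a p ≠ 0 := by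
  -- The factor `X i` forces `b i ≠ 0`, so `b` can be rescaled to have `i`-th coordinate `1`.
  obtain ⟨b, hb⟩ : ∃ b : σ → k, eval b (p * X i) ≠ 0 := by
    by_contra! h
    exact mul_ne_zero h0 (X_ne_zero i) (MvPolynomial.funext fun b => by simpa using h b)
  simp only [map_mul, eval_X, ne_eq, mul_eq_zero, not_or] at hb
  refine ⟨fun j => (b i)⁻¹ * b j, inv_mul_cancel₀ hb.2, ?_⟩
  have : eval (fun j => (b i)⁻¹ * b j) p = (b i)⁻¹ ^ d * eval b p := by
    rw [eval_eq, eval_eq, Finset.mul_sum]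
    refine Finset.sum_congr rfl fun s hs => ?_
    have hsd : ∑ j ∈ s.support, s j = d := 
      (DFunLike.congr_fun Finsupp.degree_eq_weight_one s).trans (hp (mem_support_iff.1 hs))
    rw [← hsd, ← Finset.prod_pow_eq_pow_sum, mul_left_comm, ← Finset.prod_mul_distrib]
    simp only [mul_pow]
  rw [this]
  exact mul_ne_zero (pow_ne_zero _ (inv_ne_zero hb.2)) hb.1

end MvPolynomial

/-! ### Noether normalization relative to an ideal. -/

/-- The elimination step of Noether normalization over an infinite field: if `h` and the `y i` are
algebraically dependent, then `h` is integral over the algebra generated by the `y i - a i • h` for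
suitable scalars `a i`. -/
theorem exists_isIntegral_adjoin_sub_smul {k S ι : Type*} [Field k] [Infinite k] [CommRing S]
    [Algebra k S] [Finite ι] (y : ι → S) (h : S)
    (hdep : ¬ AlgebraicIndependent k (fun o : Option ι => o.elim h y)) :
    ∃ a : ι → k, IsIntegral (Algebra.adjoin k (Set.range fun i => y i - a i • h)) h := by
  rw [algebraicIndependent_iff] at hdep
  push Not at hdep
  obtain ⟨p, hp, hp0⟩ := hdep
  have htop : MvPolynomial.homogeneousComponent p.totalDegree p ≠ 0 := by
    obtain ⟨s, hs, hsd⟩ := Finset.exists_mem_eq_sup p.support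
      (MvPolynomial.support_nonempty.2 hp0) fun s => s.sum fun _ e => e
    intro h0
    have := congrArg (MvPolynomial.coeff s) h0
    rw [MvPolynomial.coeff_homogeneousComponent, if_pos] at this
    · exact MvPolynomial.mem_support_iff.1 hs this
    · rw [MvPolynomial.totalDegree, hsd]; rfl
  obtain ⟨a, ha, hap⟩ :=
    (MvPolynomial.homogeneousComponent_isHomogeneous p.totalDegree p).exists_eval_ne_zero htop none
  refine ⟨fun i => a (some i), ?_⟩
  set B := Algebra.adjoin k (Set.range fun i => y i - a (some i) • h)
  -- Since `a none = 1`, the line `u + T a` passes through `(h, y)` at `T = h`; hence `h` is a root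
  -- of `q`, whose top coefficient is a nonzero scalar.
  let u : Option ι → B := fun o => o.elim 0 fun i =>
    ⟨y i - a (some i) • h, Algebra.subset_adjoin ⟨i, rfl⟩⟩
  obtain ⟨hd, hc⟩ := MvPolynomial.natDegree_aeval_line_le_and_coeff u a p _ le_rfl
  set q := MvPolynomial.aeval
    (fun i => Polynomial.C (u i) + Polynomial.C (algebraMap k B (a i)) * Polynomial.X) p with hq
  have hqh : Polynomial.aeval h q = 0 := by
    have : ((Polynomial.aeval (R := B) h).restrictScalars k).comp (MvPolynomial.aeval
        fun i => Polynomial.C (u i) + Polynomial.C (algebraMap k B (a i)) * Polynomial.X) =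
        MvPolynomial.aeval (fun o : Option ι => o.elim h y) := by
      refine MvPolynomial.algHom_ext fun o => ?_
      cases o with
      | none => simp [u, ha]
      | some i => simp [u, ← IsScalarTower.algebraMap_apply, ← Algebra.smul_def]
    rw [← hp, ← this]
    rfl
  set c := MvPolynomial.eval a (MvPolynomial.homogeneousComponent p.totalDegree p)
  refine ⟨Polynomial.C (algebraMap k B c⁻¹) * q, ?_, ?_⟩
  · refine Polynomial.monic_of_natDegree_le_of_coeff_eq_one p.totalDegree
      ((Polynomial.natDegree_C_mul_le _ _).trans hd) ?_
    rw [Polynomial.coeff_C_mul, hc, ← map_mul, inv_mul_cancel₀ hap, map_one]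
  · rw [← Polynomial.aeval_def, map_mul, hqh, mul_zero]

/-- Transitivity of integrality for subalgebras given by generators. -/
theorem IsIntegral.trans_adjoin {k S : Type*} [CommRing k] [CommRing S] [Algebra k S]
    {s t : Set S} (hs : ∀ x ∈ s, IsIntegral (Algebra.adjoin k t) x) {x : S}
    (hx : IsIntegral (Algebra.adjoin k s) x) : IsIntegral (Algebra.adjoin k t) x := by
  let D := (integralClosure (Algebra.adjoin k t) S).restrictScalars k
  have hle : Algebra.adjoin k s ≤ D := Algebra.adjoin_le hs
  have : IsIntegral (integralClosure (Algebra.adjoin k t) S) x :=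
    hx.map_of_comp_eq (Subalgebra.inclusion hle).toRingHom (RingHom.id S) rfl
  exact isIntegral_trans x this

namespace MvPolynomial

theorem not_algebraicIndependent_of_lt_card {k : Type} [Field k] {m : ℕ} {ι : Type} [Fintype ι]
    (hι : m < Fintype.card ι) (v : ι → MvPolynomial (Fin m) k) : ¬ AlgebraicIndependent k v := by
  intro h
  have := h.cardinalMk_le_trdeg
  rw [MvPolynomial.trdeg_of_isDomain] at this
  simp only [Cardinal.mk_fintype, Fintype.card_fin, Cardinal.lift_natCast, Nat.cast_le] at this
  omega

/-- Noether normalization relative to an ideal `I`: polynomials `y i` can be changed modulo `I` so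
that finitely many given elements `h j` of `I`, together with the `y i`, become integral over the
algebra generated by the new `y i` and at most `m - n` elements of `I`. -/
theorem exists_isIntegral_adjoin_mod_ideal {k : Type} [Field k] [Infinite k] {m n : ℕ}
    (hmn : n ≤ m) (I : Ideal (MvPolynomial (Fin m) k)) (r : ℕ) (y : Fin n → MvPolynomial (Fin m) k)
    (h : Fin r → MvPolynomial (Fin m) k) (hI : ∀ j, h j ∈ I) :
    ∃ s ≤ m - n, ∃ (y' : Fin n → MvPolynomial (Fin m) k) (h' : Fin s → MvPolynomial (Fin m) k),
      (∀ i, y' i - y i ∈ I) ∧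
      ∀ x ∈ Set.range (Sum.elim y h),
        IsIntegral (Algebra.adjoin k (Set.range (Sum.elim y' h'))) x := by
  induction r generalizing y with
  | zero =>
    exact ⟨0, Nat.zero_le _, y, h, by simp, fun x hx =>
      isIntegral_algebraMap (x := (⟨x, Algebra.subset_adjoin hx⟩ : Algebra.adjoin k _))⟩
  | succ r ih =>
    by_cases hr : r + 1 ≤ m - n
    · exact ⟨r + 1, hr, y, h, by simp, fun x hx =>
        isIntegral_algebraMap (x := (⟨x, Algebra.subset_adjoin hx⟩ : Algebra.adjoin k _))⟩
    -- Here `n + (r + 1) > m`, which forces dependence; `h 0` is the element eliminated.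
    obtain ⟨a, ha⟩ := exists_isIntegral_adjoin_sub_smul (k := k) (Sum.elim y (Fin.tail h)) (h 0)
      (not_algebraicIndependent_of_lt_card (by simp; omega) _)
    have hsmul (c : k) : c • h 0 ∈ I := by
      rw [Algebra.smul_def]; exact I.mul_mem_left _ (hI 0)
    obtain ⟨s, hs, y', h', hy', hint⟩ := ih (fun i => y i - a (.inl i) • h 0)
      (fun j => h j.succ - a (.inr j) • h 0) fun j => I.sub_mem (hI _) (hsmul _)
    refine ⟨s, hs, y', h', fun i => ?_, fun x hx => ?_⟩
    · have := I.sub_mem (hy' i) (hsmul (a (.inl i)))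
      convert this using 1
      ring
    · refine IsIntegral.trans_adjoin hint ?_
      have hset : (Set.range fun i => Sum.elim y (Fin.tail h) i - a i • h 0) =
          Set.range (Sum.elim (fun i => y i - a (.inl i) • h 0)
            fun j => h j.succ - a (.inr j) • h 0) := by
        congr 1
        funext i
        cases i <;> rfl
      rw [hset] at ha
      set B := Algebra.adjoin k (Set.range (Sum.elim (fun i => y i - a (.inl i) • h 0)
            fun j => h j.succ - a (.inr j) • h 0)) with hB
      have hsub (z : MvPolynomial (Fin m) k) (c : k) (hz : z - c • h 0 ∈ B) :
          IsIntegral B z := by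
        have h₁ : IsIntegral B (z - c • h 0) := isIntegral_algebraMap (x := (⟨_, hz⟩ : B))
        have h₂ : IsIntegral B (c • h 0) := ha.smul c
        simpa using h₁.add h₂
      obtain ⟨i | j, rfl⟩ := hx
      · exact hsub _ (a (.inl i)) (Algebra.subset_adjoin ⟨.inl i, rfl⟩)
      · refine Fin.cases ?_ (fun j => ?_) j
        · exact ha
        · exact hsub _ (a (.inr j)) (Algebra.subset_adjoin ⟨.inr j, rfl⟩)

/-! ### Primes in a fibre away from the zeros of `g`. -/

/-- Once `g` is inverted, each variable is the quotient of `X i * g` by `g`; one power of `g` is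
spent per variable in a monomial. -/
theorem exists_pow_mul_isIntegral {k σ : Type*} [Field k]
    (B : Subalgebra k (MvPolynomial σ k)) {g : MvPolynomial σ k} (hg : IsIntegral B g)
    (hXg : ∀ i, IsIntegral B (X i * g)) (f : MvPolynomial σ k) :
    ∃ N : ℕ, IsIntegral B (g ^ N * f) := by
  induction f using MvPolynomial.induction_on with
  | C c =>
    refine ⟨0, ?_⟩
    rw [pow_zero, one_mul]
    exact isIntegral_algebraMap (R := B) (x := algebraMap k B c)
  | add p q hp hq =>
    obtain ⟨a, ha⟩ := hp
    obtain ⟨b, hb⟩ := hq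
    refine ⟨a + b, ?_⟩
    rw [show g ^ (a + b) * (p + q) = g ^ b * (g ^ a * p) + g ^ a * (g ^ b * q) by ring]
    exact ((hg.pow b).mul ha).add ((hg.pow a).mul hb)
  | mul_X p i hp =>
    obtain ⟨a, ha⟩ := hp
    refine ⟨a + 1, ?_⟩
    rw [show g ^ (a + 1) * (p * X i) = g ^ a * p * (X i * g) by ring]
    exact ha.mul (hXg i)

/-- If `g` and all `X i * g` are integral over the algebra generated by the `y i` and `h j`, then
primes avoiding `g` on which the `y i` take constant values `z i` are separated by their
contractions to the polynomial ring in the `h j`. -/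
theorem comap_aeval_lt_comap_aeval {k σ ι κ : Type*} [Field k] {y : ι → MvPolynomial σ k}
    {h : κ → MvPolynomial σ k} {g : MvPolynomial σ k}
    (hg : IsIntegral (Algebra.adjoin k (Set.range (Sum.elim y h))) g)
    (hXg : ∀ i, IsIntegral (Algebra.adjoin k (Set.range (Sum.elim y h))) (X i * g))
    {p q : Ideal (MvPolynomial σ k)} [p.IsPrime] (hpq : p < q) (hgp : g ∉ p) (z : ι → k)
    (hz : ∀ i, y i - C (z i) ∈ p) :
    p.comap (aeval (R := k) h) < q.comap (aeval (R := k) h) := by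
  obtain ⟨f, hfq, hfp⟩ := Set.exists_of_ssubset hpq
  obtain ⟨N, hN⟩ := exists_pow_mul_isIntegral _ hg hXg f
  have hmem : g ^ N * f ∈ (q : Set (MvPolynomial σ k)) \ p := by
    refine ⟨q.mul_mem_left _ hfq, fun hmem => ?_⟩
    rcases Ideal.IsPrime.mem_or_mem ‹_› hmem with h' | h'
    · exact hgp (Ideal.IsPrime.mem_of_pow_mem ‹_› _ h')
    · exact hfp h'
  obtain ⟨⟨b, hb⟩, hbq, hbp⟩ := Set.exists_of_ssubset
    (Ideal.comap_lt_comap_of_integral_mem_sdiff hpq.le hmem hN)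
  -- Modulo `p` the `y i` are constants, so `b` is congruent to a polynomial in the `h j` alone.
  have hle : Algebra.adjoin k (Set.range (Sum.elim y h)) ≤
      ((Ideal.Quotient.mkₐ k p).comp (aeval (R := k) h)).range.comap (Ideal.Quotient.mkₐ k p) := by
    refine Algebra.adjoin_le ?_
    rintro _ ⟨i | j, rfl⟩
    · refine ⟨C (z i), ?_⟩
      simpa using! (Ideal.Quotient.eq.2 (hz i)).symm
    · exact ⟨X j, by simp⟩
  obtain ⟨t, ht⟩ := hle hb
  have htb : aeval h t - b ∈ p := Ideal.Quotient.eq.1 ht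
  refine SetLike.lt_iff_le_and_exists.2 ⟨Ideal.comap_mono hpq.le, t, ?_, fun htp => hbp ?_⟩
  · have := q.add_mem (hpq.le htb) hbq
    simpa using! this
  · have := p.sub_mem htp htb
    simpa using! this

end MvPolynomial

/-! ### Dimension of Zariski subspaces. -/

section ZariskiTopology

open MvPolynomial TopologicalSpace

theorem isClosed_zariskiTopology_iff {m : ℕ} {X : Set (Fin m → ℂ)} :
    @IsClosed _ (zariskiTopology m) X ↔ IsAlgebraicSubvariety X := by
  rw [← @isOpen_compl_iff _ _ (zariskiTopology m)]
  change IsAlgebraicSubvariety Xᶜᶜ ↔ _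
  rw [compl_compl]

variable {m : ℕ} {S : Set (Fin m → ℂ)}

theorem isPrime_vanishingIdeal_of_isIrreducible (Z : Set S)
    (hZ : @IsIrreducible S (TopologicalSpace.induced Subtype.val (zariskiTopology m)) Z) :
    (vanishingIdeal ℂ (Subtype.val '' Z)).IsPrime := by
  let := zariskiTopology m
  obtain ⟨⟨x, hx⟩, hirr⟩ := hZ
  rw [isPreirreducible_iff_isClosed_union_isClosed] at hirr
  have hclosed (p : MvPolynomial (Fin m) ℂ) :
      IsClosed {x : S | aeval x.1 p = 0} := by
    have : IsClosed {x : Fin m → ℂ | aeval x p = 0} :=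
      isClosed_zariskiTopology_iff.2 ⟨Ideal.span {p}, by simp [zeroLocus_span]⟩
    exact this.preimage continuous_subtype_val
  refine Ideal.isPrime_iff.2 ⟨fun h => ?_, fun {p q} hpq => ?_⟩
  · have : (1 : MvPolynomial (Fin m) ℂ) ∈ vanishingIdeal ℂ (Subtype.val '' Z) := h ▸ trivial
    simpa using this x ⟨x, hx, rfl⟩
  · rcases hirr _ _ (hclosed p) (hclosed q) fun x hx => by
      simpa using hpq x ⟨x, hx, rfl⟩ with h | h
    · exact .inl (by rintro _ ⟨x, hx, rfl⟩; exact h hx)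
    · exact .inr (by rintro _ ⟨x, hx, rfl⟩; exact h hx)

theorem vanishingIdeal_lt_of_isClosed_of_ssubset {Z Z' : Set S}
    (hZ : @IsClosed S (TopologicalSpace.induced Subtype.val (zariskiTopology m)) Z)
    (h : Z ⊂ Z') :
    vanishingIdeal ℂ (Subtype.val '' Z') < vanishingIdeal ℂ (Subtype.val '' Z) := by
  let := zariskiTopology m
  refine lt_of_le_not_ge (vanishingIdeal_anti_mono (Set.image_mono h.1)) fun hle => h.2 ?_
  obtain ⟨V, hV, rfl⟩ := isClosed_induced_iff.1 hZ
  obtain ⟨I, rfl⟩ := isClosed_zariskiTopology_iff.1 hV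
  intro x hx p hp
  refine hle (fun y hy => ?_) x ⟨x, hx, rfl⟩
  obtain ⟨y, hy, rfl⟩ := hy
  exact hy p hp

/-- If, away from the common zeros of `G`, integrality over the algebra generated by the `y i` and
`h j` holds, then a set missing the common zeros of `G` on which the `y i` are constant has
dimension at most the number of the `h j`. -/
theorem zariskiDim_le_of_isIntegral {n s : ℕ} {y : Fin n → MvPolynomial (Fin m) ℂ}
    {h : Fin s → MvPolynomial (Fin m) ℂ} {G : Set (MvPolynomial (Fin m) ℂ)}
    (hG : ∀ g ∈ G, IsIntegral (Algebra.adjoin ℂ (Set.range (Sum.elim y h))) g)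
    (hXG : ∀ g ∈ G, ∀ i, IsIntegral (Algebra.adjoin ℂ (Set.range (Sum.elim y h))) (X i * g))
    (z : Fin n → ℂ) (hSz : ∀ x ∈ S, ∀ i, eval x (y i) = z i)
    (hSG : ∀ x ∈ S, ∃ g ∈ G, eval x g ≠ 0) : zariskiDim S ≤ s := by
  let := zariskiTopology m
  -- Vanishing ideals reverse inclusions, hence the order dual.
  let φ : IrreducibleCloseds S → (PrimeSpectrum (MvPolynomial (Fin s) ℂ))ᵒᵈ := fun Z =>
    OrderDual.toDual ⟨(vanishingIdeal ℂ (Subtype.val '' (Z : Set S))).comap (aeval (R := ℂ) h),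
      have := isPrime_vanishingIdeal_of_isIrreducible (Z : Set S) Z.isIrreducible'
      inferInstance⟩
  have hφ : StrictMono φ := by
    intro Z Z' hZ
    have hlt := vanishingIdeal_lt_of_isClosed_of_ssubset Z.isClosed' hZ
    have := isPrime_vanishingIdeal_of_isIrreducible (Z' : Set S) Z'.isIrreducible'
    obtain ⟨x, hx⟩ := Z.isIrreducible'.1
    obtain ⟨g, hg, hgx⟩ := hSG x x.2
    -- The smaller set `Z` supplies a point where `g ≠ 0`; it lies in `Z'` too, so `g` avoids the
    -- smaller prime.
    refine comap_aeval_lt_comap_aeval (hG g hg) (hXG g hg) hlt (fun hgZ => hgx ?_) z fun i => ?_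
    · exact hgZ x ⟨x, hZ.1 hx, rfl⟩
    · rintro _ ⟨w, -, rfl⟩
      simp [hSz w w.2 i, aeval_eq_eval]
  calc zariskiDim S = Order.krullDim (IrreducibleCloseds S) := rfl
    _ ≤ Order.krullDim (PrimeSpectrum (MvPolynomial (Fin s) ℂ))ᵒᵈ :=
      Order.krullDim_le_of_strictMono φ hφ
    _ = ringKrullDim (MvPolynomial (Fin s) ℂ) := Order.krullDim_orderDual
    _ = s := by simp

end ZariskiTopology

/-! ### The extension theorem. -/

open MvPolynomial in
theorem propositionp (m n : ℕ) (hmn : n ≤ m) (X : Set (Fin m → ℂ))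
    (hX : IsAlgebraicSubvariety X) (f : X → (Fin n → ℂ)) (hf : IsPolynomialMapOn X f) :
    ∃ F : (Fin m → ℂ) → (Fin n → ℂ),
      IsPolynomialMap F ∧ (∀ x : X, F x = f x) ∧
        ∀ z : Fin n → ℂ, zariskiDim (F ⁻¹' {z} \ X) ≤ ((m - n : ℕ) : WithBot ℕ∞) := by
  obtain ⟨I, rfl⟩ := hX
  obtain ⟨P, hP⟩ := hf
  obtain ⟨G, rfl⟩ : I.FG := IsNoetherian.noetherian I
  have e := Fintype.equivFin (G × Option (Fin m))
  -- The index `none` gives `g`, and `some i` gives `X i * g`.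
  let H : G × Option (Fin m) → MvPolynomial (Fin m) ℂ :=
    fun j => j.2.elim j.1.1 fun i => MvPolynomial.X i * j.1.1
  have hGI (g : G) : g.1 ∈ Ideal.span (G : Set (MvPolynomial (Fin m) ℂ)) :=
    Ideal.subset_span g.2
  have hH (j) : H j ∈ Ideal.span (G : Set (MvPolynomial (Fin m) ℂ)) := by
    obtain ⟨g, _ | i⟩ := j
    · exact hGI g
    · exact Ideal.mul_mem_left _ _ (hGI g)
  obtain ⟨s, hs, y, h, hy, hint⟩ := exists_isIntegral_adjoin_mod_ideal hmn _ _ P (H ∘ e.symm)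
    fun j => hH _
  have hintH (j) : IsIntegral (Algebra.adjoin ℂ (Set.range (Sum.elim y h))) (H j) :=
    hint _ ⟨.inr (e j), by simp⟩
  refine ⟨fun x i => eval x (y i), ⟨y, fun _ _ => rfl⟩, fun x => ?_, fun z => ?_⟩
  · funext i
    have := x.2 _ (hy i)
    rw [aeval_eq_eval, map_sub, sub_eq_zero] at this
    exact this.trans (hP x i).symm
  · refine (zariskiDim_le_of_isIntegral (G := G) (fun g hg => hintH (⟨g, hg⟩, none))
      (fun g hg i => hintH (⟨g, hg⟩, some i)) z (fun x hx i => congrFun hx.1 i)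
      fun x hx => ?_).trans (by exact_mod_cast hs)
    by_contra! hcon
    refine hx.2 ?_
    rw [zeroLocus_span]
    exact hcon
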